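/- For a positive integer $k$ write $[k]=\{1,\dots,k\}$, and call $\{x,y\}\subset[k]^n$ an edge in direction $j$ if $|x_j-y_j|=1$ and $x_i=y_i$ for all $i\ne j$. A function $g$ on $[k]^n$ is an $M$-junta if there is a set $J\subset[n]$ with $|J|=M$ such that $g(x)$ depends only on $(x_j)_{j\in J}$. Real-valued functions $f,g$ on $[k]^n$ are $\epsilon$-close if $\frac1{k^n}\sum_{x\in[k]^n}|f(x)-g(x)|\le\epsilon$. There is an absolute constant $C_3>0$ such that the following holds for all positive integers $k,n,l$ and all real $B$. Let $f:[k]^n\to[l]$ satisfy $$\sum_{j=1}^n\ \mathbb E_{\text{edges }\{x,y\}\text{ in direction }j}\,|f(x)-f(y)|\le B,$$ where the expectation is over a uniformly random edge in direction $j$ (and is read as $0$ if $k=1$, when there are no edges). Then for every $\epsilon>0$ there exist $M$ and an $M$-junta $g:[k]^n\to[l]$ such that $f$ is $\epsilon$-close to $g$ and $$M\le l\exp(C_3Bk/\epsilon).$$ Moreover, one can take $C_3=2C_1$ for any constant $C_1$ with the following property: for all positive integers $k,n$, all $A\subset[k]^n$ and all $\epsilon>0$, the characteristic function $1_A$ is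 $\epsilon$-close to some $M$-junta $g:[k]^n\to\{0,1\}$ with $M\le\exp\big(C_1|\partial A|/(k^{n-1}\epsilon)\big)$, where $\partial A$ is the set of edges (in all directions) joining a point of $A$ to a point of $[k]^n\setminus A$. -/

import Mathlib

open scoped BigOperators

namespace GridJunta

/-- The vertex set `[k]^n`. The set `[k] = {1, …, k}` is represented by `Fin k = {0, …, k - 1}`;
all notions below only involve differences of values, so the shift by one is immaterial. -/
abbrev Grid (k n : ℕ) : Type := Fin n → Fin k

/-- The `ℓ¹`-grid: two points are adjacent iff they differ in exactly one coordinate, and their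
values in this coordinate differ by exactly `1`. -/
def gridGraph (k n : ℕ) : SimpleGraph (Grid k n) where
  Adj x y := ∃ j, |((y j : ℕ) : ℤ) - ((x j : ℕ) : ℤ)| = 1 ∧ ∀ i, i ≠ j → x i = y i
  symm := ⟨fun x y ⟨j, hj, h⟩ => ⟨j, by rw [abs_sub_comm]; exact hj, fun i hi => (h i hi).symm⟩⟩
  loopless := ⟨fun x ⟨j, hj, _⟩ => by simp at hj⟩

open Classical in
/-- The number `|∂A|` of edges of the grid joining `A` to its complement: each such edge is counted
once, as the ordered pair `(x, y)` with `x ∈ A` and `y ∉ A`. -/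
noncomputable def edgeBoundaryCard {k n : ℕ} (A : Finset (Grid k n)) : ℕ :=
  ((gridGraph k n).interedges A Aᶜ).card

/-- The edges `{x, y}` of the grid in direction `j`, each listed exactly once, as the ordered pair
`(x, y)` with `y = x + e_j`. -/
def dirEdges (k : ℕ) {n : ℕ} (j : Fin n) : Finset (Grid k n × Grid k n) :=
  Finset.univ.filter fun p => (p.2 j : ℕ) = (p.1 j : ℕ) + 1 ∧ ∀ i, i ≠ j → p.1 i = p.2 i

/-- A function with values in `[l]`, regarded as a real-valued function. -/
def toReal {k n l : ℕ} (f : Grid k n → Fin l) (x : Grid k n) : ℝ := ((f x : ℕ) : ℝ)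

/-- `∑_j 𝔼 |f(x) - f(y)|`, where in the `j`-th term `{x, y}` is a uniformly random edge in direction
`j` (an average over the empty set, which occurs only when there are no edges at all, is `0`). -/
noncomputable def sumEdgeDiff {k n : ℕ} (f : Grid k n → ℝ) : ℝ :=
  ∑ j : Fin n, 𝔼 p ∈ dirEdges k j, |f p.1 - f p.2|

/-- `f` and `g` are `ε`-close: `‖f - g‖₁ = k⁻ⁿ ∑_x |f(x) - g(x)| ≤ ε`. -/
def IsClose {k n : ℕ} (ε : ℝ) (f g : Grid k n → ℝ) : Prop :=
  (𝔼 x, |f x - g x|) ≤ ε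

/-- `g` is an `M`-junta: it depends only on the coordinates in some set `J` with `|J| = M`. -/
def IsJunta {k n : ℕ} {β : Type*} (M : ℕ) (g : Grid k n → β) : Prop :=
  ∃ J : Finset (Fin n), J.card = M ∧ DependsOn g (J : Set (Fin n))

/-- `C₁` is an admissible constant in the junta theorem for subsets of the `ℓ¹`-grid: for every
`A ⊆ [k]^n` and `ε > 0`, the function `1_A` is `ε`-close to a `{0,1}`-valued `M`-junta with
`M ≤ exp(C₁ |∂A| / (k^{n-1} ε))`. -/
def BooleanJuntaConstant (C₁ : ℝ) : Prop :=
  ∀ k n : ℕ, 1 ≤ k → 1 ≤ n → ∀ (A : Finset (Grid k n)) (ε : ℝ), 0 < ε →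
    ∃ (M : ℕ) (g : Grid k n → Fin 2), IsJunta M g ∧
      IsClose ε (Set.indicator (A : Set (Grid k n)) 1) (toReal g) ∧
      (M : ℝ) ≤ Real.exp (C₁ * edgeBoundaryCard A / ((k : ℝ) ^ (n - 1) * ε))

/-- `C₃` is an admissible constant in the junta theorem for `[l]`-valued functions on the
`ℓ¹`-grid. -/
def SumJuntaConstant (C₃ : ℝ) : Prop :=
  ∀ k n l : ℕ, 1 ≤ k → 1 ≤ n → 1 ≤ l → ∀ (f : Grid k n → Fin l) (B : ℝ),
    sumEdgeDiff (toReal f) ≤ B → ∀ ε : ℝ, 0 < ε →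
      ∃ (M : ℕ) (g : Grid k n → Fin l), IsJunta M g ∧ IsClose ε (toReal f) (toReal g) ∧
        (M : ℝ) ≤ l * Real.exp (C₃ * B * k / ε)

end GridJunta

/-! Layer-cake reduction to sets. Write `f` as the sum of the indicators of its `l - 1` superlevel
sets. Variation along an edge is additive over levels, so the edge boundaries `b t` have total at
most `S = k ^ n * B`. Each level is approximated with its own error, roughly proportional to `b t`:
this makes all the exponents at most `2 * C * B * k / ε` while the errors still add up to at most
`ε`. The sum of the level juntas is again `[l]`-valued, whether or not they are nested, and depends
on the union of their coordinate sets. This gives `C₃ = 2 * C₁`.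

An admissible `C₁` comes from Friedgut's theorem on the discrete cube, `Hypercube.exists_junta`.
Encode each coordinate in `[k]` by a block of `m` bits, via integer division of the binary value by
`q = 2 ^ m / k`. Flipping bit `i` moves the value by `2 ^ i`, so each edge of a line is crossed by
at most `2 * 2 ^ i` blocks; the geometric sum over `i` bounds the total influence by a multiple of
`|∂A| / k ^ (n - 1)`, independently of `m`. For large `m` the encoding nearly preserves measure, and
a cube junta is carried back along a section acting separately in each coordinate.

Friedgut's theorem itself rests on Bonami's fourth-moment inequality `expect_pow_four_le`: bits of
small influence carry little low-degree Fourier weight, and the total influence controls the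
high-degree weight. -/

namespace Hypercube

/-! ### Walsh–Fourier analysis and hypercontractivity on the cube. -/

variable {ι : Type*}

/-- The sign `(-1) ^ a` of a bit. -/
def sign (a : Fin 2) : ℝ := if a = 0 then 1 else -1

/-- The Walsh character of a set of coordinates. -/
def character (S : Finset ι) (x : ι → Fin 2) : ℝ := ∏ i ∈ S, sign (x i)

lemma sign_add_one (a : Fin 2) : sign (a + 1) = -sign a := by
  fin_cases a <;> simp [sign]

lemma sign_mul_self (a : Fin 2) : sign a * sign a = 1 := by
  fin_cases a <;> simp [sign]

lemma sign_mul_sign_of_ne {a b : Fin 2} (h : a ≠ b) : sign a * sign b = -1 := by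
  fin_cases a <;> fin_cases b <;> simp_all [sign]

lemma character_mul_self (S : Finset ι) (x : ι → Fin 2) : character S x * character S x = 1 := by
  rw [character, ← Finset.prod_mul_distrib]
  exact Finset.prod_eq_one fun i _ => sign_mul_self _

variable [DecidableEq ι]

/-- The point obtained from `x` by flipping the `i`-th bit. -/
def flip (i : ι) (x : ι → Fin 2) : ι → Fin 2 := Function.update x i (x i + 1)

lemma flip_apply_same (i : ι) (x : ι → Fin 2) : flip i x i = x i + 1 := by simp [flip]

lemma flip_apply_of_ne {i j : ι} (h : j ≠ i) (x : ι → Fin 2) : flip i x j = x j := by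
  simp [flip, h]

lemma flip_flip (i : ι) (x : ι → Fin 2) : flip i (flip i x) = x := by
  funext j
  rcases eq_or_ne j i with rfl | h
  · rw [flip_apply_same, flip_apply_same, add_assoc]; simp
  · rw [flip_apply_of_ne h, flip_apply_of_ne h]

lemma flip_involutive (i : ι) : Function.Involutive (flip i) := flip_flip i

lemma character_flip_of_mem {S : Finset ι} {i : ι} (h : i ∈ S) (x : ι → Fin 2) :
    character S (flip i x) = -character S x := by
  rw [character, character, ← Finset.mul_prod_erase _ _ h, ← Finset.mul_prod_erase S _ h,
    flip_apply_same, sign_add_one, neg_mul]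
  congr 2
  exact Finset.prod_congr rfl fun j hj => by rw [flip_apply_of_ne (Finset.ne_of_mem_erase hj)]

lemma character_flip_of_notMem {S : Finset ι} {i : ι} (h : i ∉ S) (x : ι → Fin 2) :
    character S (flip i x) = character S x :=
  Finset.prod_congr rfl fun j hj => by
    rw [flip_apply_of_ne (by rintro rfl; exact h hj)]

variable [Fintype ι]

/-- The Walsh–Fourier coefficient of `f` at `S`. -/
noncomputable def fourier (f : (ι → Fin 2) → ℝ) (S : Finset ι) : ℝ := 𝔼 x, f x * character S x

lemma expect_flip (i : ι) (F : (ι → Fin 2) → ℝ) : 𝔼 x, F (flip i x) = 𝔼 x, F x :=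
  Fintype.expect_equiv (flip_involutive i).toPerm _ _ fun _ => rfl

lemma expect_eq_zero_of_flip (i : ι) {F : (ι → Fin 2) → ℝ} (h : ∀ x, F (flip i x) = -F x) :
    𝔼 x, F x = 0 := by
  have h1 := expect_flip i F
  simp only [h, Finset.expect_neg_distrib] at h1
  linarith

lemma expect_character_mul (S T : Finset ι) :
    𝔼 x, character S x * character T x = if S = T then 1 else 0 := by
  split_ifs with h
  · subst h
    simp [character_mul_self]
  · obtain ⟨i, hi⟩ : ∃ i, ¬(i ∈ S ↔ i ∈ T) := by
      by_contra! hc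
      exact h (Finset.ext hc)
    refine expect_eq_zero_of_flip i fun x => ?_
    by_cases h1 : i ∈ S <;> by_cases h2 : i ∈ T
    · simp_all
    · rw [character_flip_of_mem h1, character_flip_of_notMem h2, neg_mul]
    · rw [character_flip_of_notMem h1, character_flip_of_mem h2, mul_neg]
    · simp_all

lemma expect_sum_mul_character (A : Finset (Finset ι)) (c : Finset ι → ℝ) (T : Finset ι) :
    𝔼 x, (∑ S ∈ A, c S * character S x) * character T x = if T ∈ A then c T else 0 := by
  simp_rw [Finset.sum_mul, mul_assoc]
  rw [Finset.expect_sum_comm]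
  simp_rw [← Finset.mul_expect, expect_character_mul, mul_ite, mul_one, mul_zero]
  simp

/-- The sum over `S` is the expansion of `∏ i, (1 + sign (x i) * sign (y i))`, which has a zero
factor wherever `x` and `y` differ. -/
lemma sum_character_mul (x y : ι → Fin 2) :
    ∑ S : Finset ι, character S x * character S y =
      if x = y then (Fintype.card (ι → Fin 2) : ℝ) else 0 := by
  have h : ∑ S : Finset ι, character S x * character S y = ∏ i, (1 + sign (x i) * sign (y i)) := by
    rw [Finset.prod_one_add, Finset.powerset_univ]
    exact Finset.sum_congr rfl fun S _ => by rw [character, character, Finset.prod_mul_distrib]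
  rw [h]
  split_ifs with hxy
  · subst hxy
    simp [sign_mul_self, one_add_one_eq_two]
  · obtain ⟨i, hi⟩ := Function.ne_iff.1 hxy
    exact Finset.prod_eq_zero (Finset.mem_univ i) (by rw [sign_mul_sign_of_ne hi]; norm_num)

theorem sum_fourier_mul_character (f : (ι → Fin 2) → ℝ) (y : ι → Fin 2) :
    ∑ S, fourier f S * character S y = f y := by
  simp_rw [fourier, Finset.expect_mul, mul_assoc]
  rw [← Finset.expect_sum_comm]
  simp_rw [← Finset.mul_sum, sum_character_mul]
  rw [Fintype.expect_eq_sum_div_card]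
  simp

theorem expect_sq_eq_sum_fourier_sq (f : (ι → Fin 2) → ℝ) :
    𝔼 x, f x ^ 2 = ∑ S, fourier f S ^ 2 := by
  have h : ∀ x, f x ^ 2 = ∑ S, fourier f S * (f x * character S x) := fun x => by
    rw [sq]
    nth_rewrite 2 [← sum_fourier_mul_character f x]
    rw [Finset.mul_sum]
    exact Finset.sum_congr rfl fun S _ => by ring
  simp_rw [h]
  rw [Finset.expect_sum_comm]
  exact Finset.sum_congr rfl fun S _ => by rw [← Finset.mul_expect, sq]; rfl

lemma expect_sq_sum_character (A : Finset (Finset ι)) (c : Finset ι → ℝ) :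
    𝔼 x, (∑ S ∈ A, c S * character S x) ^ 2 = ∑ S ∈ A, c S ^ 2 := by
  rw [expect_sq_eq_sum_fourier_sq]
  simp_rw [fourier, expect_sum_mul_character]
  simp [ite_pow]

/-- The Bonami hypercontractive inequality, as a bound on fourth moments. -/
theorem expect_pow_four_le (T : Finset ι) (c : Finset ι → ℝ) :
    𝔼 x, (∑ S ∈ T.powerset, c S * character S x) ^ 4 ≤
      (∑ S ∈ T.powerset, 3 ^ S.card * c S ^ 2) ^ 2 := by
  induction T using Finset.induction_on generalizing c with
  | empty =>
    simp [character]
    exact (by ring : c ∅ ^ 4 = (c ∅ ^ 2) ^ 2).le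
  | insert a T ha ih =>
    have hmem : ∀ S ∈ T.powerset, a ∉ S := fun S hS haS => ha (Finset.mem_powerset.1 hS haS)
    set g : (ι → Fin 2) → ℝ := fun x => ∑ S ∈ T.powerset, c S * character S x with hg
    set h : (ι → Fin 2) → ℝ := fun x => ∑ S ∈ T.powerset, c (insert a S) * character S x with hh
    set G := ∑ S ∈ T.powerset, 3 ^ S.card * c S ^ 2 with hG
    set H := ∑ S ∈ T.powerset, 3 ^ S.card * c (insert a S) ^ 2 with hH
    have hG0 : 0 ≤ G := Finset.sum_nonneg fun S _ => by positivity
    have hH0 : 0 ≤ H := Finset.sum_nonneg fun S _ => by positivity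
    have hsum : ∀ x, ∑ S ∈ (insert a T).powerset, c S * character S x =
        g x + sign (x a) * h x := fun x => by
      rw [Finset.sum_powerset_insert ha, hg, hh, Finset.mul_sum]
      congr 1
      refine Finset.sum_congr rfl fun S hS => ?_
      rw [character, Finset.prod_insert (hmem S hS), character]
      ring
    have hnorm : ∑ S ∈ (insert a T).powerset, 3 ^ S.card * c S ^ 2 = G + 3 * H := by
      rw [Finset.sum_powerset_insert ha, hG, hH, Finset.mul_sum]
      congr 1
      refine Finset.sum_congr rfl fun S hS => ?_
      rw [Finset.card_insert_of_notMem (hmem S hS)]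
      ring
    have hgf : ∀ x, g (flip a x) = g x := fun x => Finset.sum_congr rfl fun S hS => by
      rw [character_flip_of_notMem (hmem S hS)]
    have hhf : ∀ x, h (flip a x) = h x := fun x => Finset.sum_congr rfl fun S hS => by
      rw [character_flip_of_notMem (hmem S hS)]
    -- Terms odd in the bit `a` are kept together because their mean vanishes.
    have hexp : ∀ x, (g x + sign (x a) * h x) ^ 4 =
        g x ^ 4 + 6 * (g x ^ 2 * h x ^ 2) + h x ^ 4 +
          sign (x a) * (4 * g x ^ 3 * h x + 4 * g x * h x ^ 3) := fun x => by
      have := sign_mul_self (x a)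
      linear_combination (6 * g x ^ 2 * h x ^ 2 + 4 * g x * sign (x a) * h x ^ 3 +
        h x ^ 4 * (1 + sign (x a) ^ 2)) * this
    have hodd : 𝔼 x, sign (x a) * (4 * g x ^ 3 * h x + 4 * g x * h x ^ 3) = 0 :=
      expect_eq_zero_of_flip a fun x => by
        rw [flip_apply_same, sign_add_one, hgf, hhf, neg_mul]
    have ihg : 𝔼 x, g x ^ 4 ≤ G ^ 2 := ih c
    have ihh : 𝔼 x, h x ^ 4 ≤ H ^ 2 := ih fun S => c (insert a S)
    have hmix : 𝔼 x, g x ^ 2 * h x ^ 2 ≤ G * H := by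
      refine abs_le_of_sq_le_sq' ?_ (by positivity) |>.2
      have hcs := Finset.expect_mul_sq_le_sq_mul_sq Finset.univ (fun x => g x ^ 2)
        (fun x => h x ^ 2)
      simp only [← pow_mul] at hcs
      norm_num at hcs
      calc _ ≤ _ := hcs
        _ ≤ G ^ 2 * H ^ 2 := mul_le_mul ihg ihh
            (Finset.expect_nonneg fun x _ => by positivity) (by positivity)
        _ = _ := by ring
    simp_rw [hsum, hexp]
    rw [hnorm, Finset.expect_add_distrib, Finset.expect_add_distrib, Finset.expect_add_distrib,
      hodd, ← Finset.mul_expect]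
    -- `G² + 6GH + H² ≤ (G + 3H)²`: the cross term is what forces the weight `3` per bit.
    nlinarith [mul_nonneg hG0 hH0, sq_nonneg H]

end Hypercube

/-! ### Friedgut's junta theorem on the cube. -/

namespace Hypercube

lemma sq_sub_eq_abs {α : Type*} {f : α → ℝ} (hf : ∀ x, f x = 0 ∨ f x = 1) (x y : α) :
    (f x - f y) ^ 2 = |f x - f y| := by
  rcases hf x with h | h <;> rcases hf y with h' | h' <;> rw [h, h'] <;> norm_num

variable {ι : Type*} [DecidableEq ι] [Fintype ι]

/-- The influence of the `i`-th bit. -/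
noncomputable def influence (f : (ι → Fin 2) → ℝ) (i : ι) : ℝ := 𝔼 x, |f x - f (flip i x)|

lemma influence_nonneg (f : (ι → Fin 2) → ℝ) (i : ι) : 0 ≤ influence f i :=
  Finset.expect_nonneg fun _ _ => abs_nonneg _

section Boolean

variable {f : (ι → Fin 2) → ℝ}

/-- Parseval for `f - f ∘ flip i`, whose coefficient is `2 * fourier f S` if `i ∈ S` and `0`
otherwise; its square equals its absolute value since `f` is Boolean. -/
lemma sum_fourier_sq_of_mem (hf : ∀ x, f x = 0 ∨ f x = 1) (i : ι) :
    ∑ S with i ∈ S, fourier f S ^ 2 = influence f i / 4 := by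
  have hc : ∀ S, fourier (fun x => f x - f (flip i x)) S = if i ∈ S then 2 * fourier f S else 0 := by
    intro S
    have h1 := expect_flip i fun x => f (flip i x) * character S x
    simp only [flip_flip] at h1
    simp only [fourier, sub_mul, Finset.expect_sub_distrib, ← h1]
    split_ifs with h
    · simp_rw [character_flip_of_mem h, mul_neg, Finset.expect_neg_distrib]
      ring
    · simp_rw [character_flip_of_notMem h, sub_self]
  have hp := expect_sq_eq_sum_fourier_sq fun x => f x - f (flip i x)
  simp_rw [hc, sq_sub_eq_abs hf, ite_pow, mul_pow] at hp
  rw [influence, hp, Finset.sum_filter, Finset.sum_div]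
  refine Finset.sum_congr rfl fun S _ => ?_
  split_ifs <;> ring

lemma sum_card_mul_fourier_sq (hf : ∀ x, f x = 0 ∨ f x = 1) :
    ∑ S, (S.card : ℝ) * fourier f S ^ 2 = (∑ i, influence f i) / 4 := by
  rw [Finset.sum_div]
  simp_rw [← sum_fourier_sq_of_mem hf, Finset.sum_filter]
  rw [Finset.sum_comm]
  refine Finset.sum_congr rfl fun S _ => ?_
  simp

/-- The low-degree Fourier weight involving a bit of small influence is much smaller than the
influence. -/
lemma sum_fourier_sq_low_degree (hf : ∀ x, f x = 0 ∨ f x = 1) (i : ι) (d : ℕ) :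
    (∑ S with i ∈ S ∧ S.card ≤ d, fourier f S ^ 2) ^ 2 ≤ 9 ^ d * influence f i ^ 3 / 16 := by
  set A : Finset (Finset ι) := {S | i ∈ S ∧ S.card ≤ d} with hA
  set W := ∑ S ∈ A, fourier f S ^ 2 with hW
  set μ := influence f i with hμ
  have hμ0 : 0 ≤ μ := influence_nonneg f i
  have hW0 : 0 ≤ W := Finset.sum_nonneg fun _ _ => sq_nonneg _
  set P : (ι → Fin 2) → ℝ := fun x => ∑ S ∈ A, fourier f S * character S x with hP
  have hPflip : ∀ x, P (flip i x) = -P x := fun x => by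
    simp only [hP]
    rw [← Finset.sum_neg_distrib]
    refine Finset.sum_congr rfl fun S hS => ?_
    rw [character_flip_of_mem (Finset.mem_filter.1 hS).2.1, mul_neg]
  have hPf : 𝔼 x, P x * f x = W := by
    simp_rw [hP, Finset.sum_mul]
    rw [Finset.expect_sum_comm]
    refine Finset.sum_congr rfl fun S _ => ?_
    rw [sq, fourier, Finset.mul_expect]
    exact Finset.expect_congr rfl fun x _ => by rw [← fourier]; ring
  have hPD : 𝔼 x, P x * (f x - f (flip i x)) = 2 * W := by
    have h1 := expect_flip i fun x => P x * f (flip i x)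
    simp only [flip_flip, hPflip, neg_mul, Finset.expect_neg_distrib, hPf] at h1
    simp_rw [mul_sub]
    rw [Finset.expect_sub_distrib, hPf]
    linarith
  have hfour : 𝔼 x, P x ^ 4 ≤ 9 ^ d * W ^ 2 := by
    have hb := expect_pow_four_le (Finset.univ : Finset ι) fun S => if S ∈ A then fourier f S else 0
    simp only [Finset.powerset_univ, ite_mul, zero_mul, ite_pow, mul_ite, ne_eq, OfNat.ofNat_ne_zero,
      not_false_eq_true, zero_pow, mul_zero, Finset.sum_ite_mem, Finset.univ_inter] at hb
    refine hb.trans ?_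
    have h9 : (9 : ℝ) ^ d = (3 ^ d) ^ 2 := by rw [← pow_mul, mul_comm, pow_mul]; norm_num
    rw [h9, ← mul_pow]
    refine pow_le_pow_left₀ (Finset.sum_nonneg fun _ _ => by positivity) ?_ 2
    rw [hW, Finset.mul_sum]
    refine Finset.sum_le_sum fun S hS => ?_
    have := (Finset.mem_filter.1 hS).2.2
    gcongr
    norm_num
  -- The difference `D` takes values in `{-1, 0, 1}`, so `|D| * D = D` and `D² = |D|`; two
  -- Cauchy–Schwarz steps then lead from `𝔼 P D = 2W` to the fourth moment of `P`.
  have hcs1 : (2 * W) ^ 2 ≤ (𝔼 x, P x ^ 2 * |f x - f (flip i x)|) * μ := by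
    have h := Finset.expect_mul_sq_le_sq_mul_sq Finset.univ
      (fun x => P x * |f x - f (flip i x)|) (fun x => f x - f (flip i x))
    have e1 : ∀ x, P x * |f x - f (flip i x)| * (f x - f (flip i x)) =
        P x * (f x - f (flip i x)) := fun x => by
      rcases hf x with h | h <;> rcases hf (flip i x) with h' | h' <;> rw [h, h'] <;> norm_num
    have e2 : ∀ x, (P x * |f x - f (flip i x)|) ^ 2 = P x ^ 2 * |f x - f (flip i x)| := fun x => by
      rw [mul_pow, sq_abs, sq_sub_eq_abs hf]
    simp_rw [e1, e2, sq_sub_eq_abs hf, hPD] at h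
    exact h
  have hcs2 : (𝔼 x, P x ^ 2 * |f x - f (flip i x)|) ^ 2 ≤ (9 ^ d * W ^ 2) * μ := by
    have h := Finset.expect_mul_sq_le_sq_mul_sq Finset.univ
      (fun x => P x ^ 2) (fun x => |f x - f (flip i x)|)
    simp_rw [sq_abs, sq_sub_eq_abs hf, ← pow_mul] at h
    exact h.trans (mul_le_mul_of_nonneg_right hfour hμ0)
  have hfin : W ^ 2 * (16 * W ^ 2) ≤ W ^ 2 * (9 ^ d * μ ^ 3) := by
    calc W ^ 2 * (16 * W ^ 2) = ((2 * W) ^ 2) ^ 2 := by ring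
      _ ≤ ((𝔼 x, P x ^ 2 * |f x - f (flip i x)|) * μ) ^ 2 :=
        pow_le_pow_left₀ (sq_nonneg _) hcs1 2
      _ = (𝔼 x, P x ^ 2 * |f x - f (flip i x)|) ^ 2 * μ ^ 2 := by ring
      _ ≤ (9 ^ d * W ^ 2) * μ * μ ^ 2 := mul_le_mul_of_nonneg_right hcs2 (sq_nonneg _)
      _ = _ := by ring
  rcases hW0.eq_or_lt with h0 | h0
  · rw [← h0, sq, mul_zero]
    positivity
  · have := le_of_mul_le_mul_left hfin (by positivity)
    linarith

/-- If almost all Fourier weight sits on subsets of `J`, then rounding the corresponding part of the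
Fourier expansion gives a good approximation depending only on `J`. -/
lemma exists_dependsOn_of_fourier (hf : ∀ x, f x = 0 ∨ f x = 1) (J : Finset ι) {ε : ℝ}
    (hJ : ∑ S with ¬S ⊆ J, fourier f S ^ 2 ≤ ε / 4) :
    ∃ g : (ι → Fin 2) → ℝ, (∀ x, g x = 0 ∨ g x = 1) ∧ DependsOn g (J : Set ι) ∧
      𝔼 x, |f x - g x| ≤ ε := by
  set h : (ι → Fin 2) → ℝ := fun x => ∑ S ∈ J.powerset, fourier f S * character S x with hh
  have hdep : ∀ x y : ι → Fin 2, (∀ i ∈ J, x i = y i) → h x = h y := fun x y hxy => by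
    refine Finset.sum_congr rfl fun S hS => ?_
    congr 1
    exact Finset.prod_congr rfl fun i hi => by rw [hxy i (Finset.mem_powerset.1 hS hi)]
  have hdist : 𝔼 x, (f x - h x) ^ 2 = ∑ S with ¬S ⊆ J, fourier f S ^ 2 := by
    rw [← expect_sq_sum_character]
    refine Finset.expect_congr rfl fun x _ => ?_
    rw [← sum_fourier_mul_character f x,
      ← Finset.sum_filter_add_sum_filter_not Finset.univ (fun S => S ⊆ J)]
    have : Finset.univ.filter (fun S => S ⊆ J) = J.powerset := by ext; simp
    rw [this, add_sub_cancel_left]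
  refine ⟨fun x => if 1 / 2 ≤ h x then 1 else 0, fun x => ?_, fun x y hxy => ?_, ?_⟩
  · dsimp only
    split_ifs <;> simp
  · simp only [hdep x y hxy]
  -- Rounding errs only where `|f - h| ≥ 1 / 2`.
  · have hpt : ∀ x, |f x - if 1 / 2 ≤ h x then 1 else 0| ≤ 4 * (f x - h x) ^ 2 := fun x => by
      split_ifs with hx <;> rcases hf x with h' | h' <;> rw [h'] <;> norm_num <;>
        nlinarith [sq_nonneg (1 - h x)]
    calc _ ≤ 𝔼 x, 4 * (f x - h x) ^ 2 := Finset.expect_le_expect fun x _ => hpt x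
      _ = 4 * ∑ S with ¬S ⊆ J, fourier f S ^ 2 := by rw [← Finset.mul_expect, hdist]
      _ ≤ ε := by linarith

/-- The Fourier weight outside subsets of `J`, when every bit outside `J` has influence below `τ`. -/
lemma sum_fourier_sq_not_subset_le (hf : ∀ x, f x = 0 ∨ f x = 1) (J : Finset ι) (d : ℕ) {δ : ℝ}
    (hδ : 0 ≤ δ) (hJ : ∀ i ∉ J, 9 ^ d * influence f i ≤ δ ^ 2) :
    (∑ S with ¬S ⊆ J, fourier f S ^ 2) ≤
      (∑ i, influence f i) / (4 * (d + 1)) + δ * (∑ i, influence f i) / 4 := by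
  have hlow : ∀ i ∉ J, ∑ S with i ∈ S ∧ S.card ≤ d, fourier f S ^ 2 ≤ δ * influence f i / 4 := by
    intro i hi
    have h0 := influence_nonneg f i
    refine abs_le_of_sq_le_sq' ?_ (by positivity) |>.2
    refine (sum_fourier_sq_low_degree hf i d).trans ?_
    have := mul_le_mul_of_nonneg_right (hJ i hi) (sq_nonneg (influence f i))
    nlinarith
  have hhigh : ∑ S with d < S.card, fourier f S ^ 2 ≤ (∑ i, influence f i) / (4 * (d + 1)) := by
    rw [le_div_iff₀ (by positivity), mul_comm, mul_assoc, ← le_div_iff₀' (by norm_num),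
      ← sum_card_mul_fourier_sq hf, Finset.mul_sum, Finset.sum_filter]
    refine Finset.sum_le_sum fun S _ => ?_
    split_ifs with h
    · have : (d : ℝ) + 1 ≤ S.card := by exact_mod_cast h
      gcongr
    · positivity
  -- A set not inside `J` is either large or a small set containing some bit outside `J`.
  have hsplit : ∑ S with ¬S ⊆ J, fourier f S ^ 2 ≤ ∑ S with d < S.card, fourier f S ^ 2 +
      ∑ i ∈ Jᶜ, ∑ S with i ∈ S ∧ S.card ≤ d, fourier f S ^ 2 := by
    simp_rw [Finset.sum_filter]
    rw [Finset.sum_comm, ← Finset.sum_add_distrib]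
    refine Finset.sum_le_sum fun S _ => ?_
    have hnn : ∀ i ∈ Jᶜ, 0 ≤ if i ∈ S ∧ S.card ≤ d then fourier f S ^ 2 else 0 := fun i _ => by
      split_ifs <;> positivity
    by_cases hS : S ⊆ J
    · rw [if_neg (not_not.2 hS)]
      exact add_nonneg (by split_ifs <;> positivity) (Finset.sum_nonneg hnn)
    · rw [if_pos hS]
      by_cases hd : d < S.card
      · rw [if_pos hd]
        linarith [Finset.sum_nonneg hnn]
      · obtain ⟨i, hiS, hiJ⟩ := Finset.not_subset.1 hS
        have := Finset.single_le_sum hnn (Finset.mem_compl.2 hiJ)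
        rw [if_pos ⟨hiS, not_lt.1 hd⟩] at this
        rw [if_neg hd]
        linarith
  have hsum : ∑ i ∈ Jᶜ, ∑ S with i ∈ S ∧ S.card ≤ d, fourier f S ^ 2 ≤
      δ * (∑ i, influence f i) / 4 := by
    calc _ ≤ ∑ i ∈ Jᶜ, δ * influence f i / 4 :=
          Finset.sum_le_sum fun i hi => hlow i (Finset.mem_compl.1 hi)
      _ ≤ ∑ i, δ * influence f i / 4 :=
          Finset.sum_le_sum_of_subset_of_nonneg (Finset.subset_univ _) fun i _ _ => by
            have := influence_nonneg f i
            positivity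
      _ = _ := by rw [← Finset.sum_div, Finset.mul_sum]
  linarith

/-- Friedgut's junta theorem on the discrete cube. -/
theorem exists_junta (hf : ∀ x, f x = 0 ∨ f x = 1) {I ε : ℝ} (hI : ∑ i, influence f i ≤ I)
    (hε : 0 < ε) :
    ∃ (J : Finset ι) (g : (ι → Fin 2) → ℝ), (∀ x, g x = 0 ∨ g x = 1) ∧ DependsOn g (J : Set ι) ∧
      𝔼 x, |f x - g x| ≤ ε ∧ (J.card : ℝ) ≤ Real.exp (10 * I / ε) := by
  have hI0 : 0 ≤ I := (Finset.sum_nonneg fun i _ => influence_nonneg f i).trans hI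
  rcases lt_or_ge 1 ε with hε1 | hε1
  · refine ⟨∅, fun _ => 0, fun _ => Or.inl rfl, fun _ _ _ => rfl, ?_, by simp; positivity⟩
    refine Finset.expect_le Finset.univ_nonempty fun x _ => ?_
    rcases hf x with h | h <;> rw [h] <;> norm_num <;> linarith
  rcases le_or_gt I ε with hR | hR
  · obtain ⟨g, hg, hdep, hclose⟩ := exists_dependsOn_of_fourier (ε := ε) hf ∅ (by
      refine le_trans ?_ ((sum_card_mul_fourier_sq hf).trans_le
        (div_le_div_of_nonneg_right (hI.trans hR) (by norm_num)))
      rw [Finset.sum_filter]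
      refine Finset.sum_le_sum fun S _ => ?_
      split_ifs with h
      · positivity
      · have : (1 : ℝ) ≤ S.card := by
          exact_mod_cast Finset.card_pos.2 (Finset.nonempty_iff_ne_empty.2 fun h' => h h'.subset)
        exact le_mul_of_one_le_left (sq_nonneg _) this)
    exact ⟨∅, g, hg, hdep, hclose, by simp; positivity⟩
  · set R := I / ε with hRdef
    have hR1 : 1 < R := (one_lt_div hε).2 hR
    have hIR : I = R * ε := by rw [hRdef]; field_simp
    -- With this `d` and `δ = 1 / (2 * R)`, the high-degree and low-degree weights are each at most
    -- `ε / 8`.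
    set d := ⌊2 * R⌋₊ with hd
    have hd1 : 2 * R < d + 1 := Nat.lt_floor_add_one _
    have hd2 : (d : ℝ) ≤ 2 * R := Nat.floor_le (by positivity)
    set J : Finset ι := {i | (1 / (2 * R)) ^ 2 < 9 ^ d * influence f i} with hJ
    have hbound := sum_fourier_sq_not_subset_le hf J d (δ := 1 / (2 * R)) (by positivity)
      fun i hi => by simpa [hJ] using hi
    obtain ⟨g, hg, hdep, hclose⟩ := exists_dependsOn_of_fourier (ε := ε) hf J (by
      refine hbound.trans ?_
      have h1 : (∑ i, influence f i) / (4 * (d + 1)) ≤ ε / 8 := by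
        rw [div_le_iff₀ (by positivity)]
        nlinarith
      have h2 : 1 / (2 * R) * (∑ i, influence f i) / 4 ≤ ε / 8 := by
        have : 1 / (2 * R) * (∑ i, influence f i) ≤ 1 / (2 * R) * I := by gcongr
        have h3 : 1 / (2 * R) * I = ε / 2 := by rw [hIR]; field_simp
        linarith
      linarith)
    refine ⟨J, g, hg, hdep, hclose, ?_⟩
    have hcard : (J.card : ℝ) * (1 / (2 * R)) ^ 2 ≤ 9 ^ d * I := by
      calc (J.card : ℝ) * (1 / (2 * R)) ^ 2 = ∑ i ∈ J, (1 / (2 * R)) ^ 2 := by simp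
        _ ≤ ∑ i ∈ J, 9 ^ d * influence f i :=
          Finset.sum_le_sum fun i hi => (Finset.mem_filter.1 hi).2.le
        _ ≤ ∑ i, 9 ^ d * influence f i :=
          Finset.sum_le_sum_of_subset_of_nonneg (Finset.subset_univ _) fun i _ _ => by
            have := influence_nonneg f i
            positivity
        _ ≤ 9 ^ d * I := by rw [← Finset.mul_sum]; gcongr
    have hcard' : (J.card : ℝ) ≤ 4 * R ^ 3 * 9 ^ d := by
      have hR2 : (1 / (2 * R)) ^ 2 * (4 * R ^ 2) = 1 := by
        have : R ≠ 0 := by positivity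
        rw [div_pow, mul_pow, one_pow, div_mul_eq_mul_div, one_mul, div_eq_one_iff_eq (by positivity)]
        norm_num
      calc (J.card : ℝ) = J.card * (1 / (2 * R)) ^ 2 * (4 * R ^ 2) := by
            rw [mul_assoc, hR2, mul_one]
        _ ≤ 9 ^ d * I * (4 * R ^ 2) := by gcongr
        _ ≤ 9 ^ d * R * (4 * R ^ 2) := by
          gcongr
          nlinarith
        _ = _ := by ring
    have he1 : (2.7 : ℝ) < Real.exp 1 := lt_trans (by norm_num) Real.exp_one_gt_d9
    have h4 : (4 : ℝ) ≤ Real.exp (2 * R) := by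
      calc (4 : ℝ) ≤ Real.exp 1 ^ 2 := by nlinarith
        _ = Real.exp 2 := by rw [← Real.exp_nat_mul]; norm_num
        _ ≤ _ := Real.exp_le_exp.2 (by linarith)
    have h9 : (9 : ℝ) ^ d ≤ Real.exp (5 * R) := by
      have h9' : (9 : ℝ) ≤ Real.exp (5 / 2) := by
        refine abs_le_of_sq_le_sq' ?_ (Real.exp_pos _).le |>.2
        calc (9 : ℝ) ^ 2 ≤ 2.7 ^ 5 := by norm_num
          _ ≤ Real.exp 1 ^ 5 := by gcongr
          _ = Real.exp (5 / 2) ^ 2 := by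
            rw [← Real.exp_nat_mul, ← Real.exp_nat_mul]; norm_num
      calc (9 : ℝ) ^ d ≤ Real.exp (5 / 2) ^ d := by gcongr
        _ = Real.exp (d * (5 / 2)) := by rw [← Real.exp_nat_mul]
        _ ≤ _ := Real.exp_le_exp.2 (by linarith)
    have h3 : R ^ 3 ≤ Real.exp (3 * R) := by
      have : R ≤ Real.exp R := by linarith [Real.add_one_le_exp R]
      calc R ^ 3 ≤ Real.exp R ^ 3 := by gcongr
        _ = _ := by rw [← Real.exp_nat_mul]; norm_num
    calc (J.card : ℝ) ≤ 4 * R ^ 3 * 9 ^ d := hcard'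
      _ ≤ Real.exp (2 * R) * Real.exp (3 * R) * Real.exp (5 * R) := by gcongr
      _ = Real.exp (10 * I / ε) := by
        rw [← Real.exp_add, ← Real.exp_add, mul_div_assoc, ← hRdef]; ring_nf

end Boolean

end Hypercube

/-! ### Edges of the grid by direction, and the edge boundary. -/

namespace GridJunta

section Edges

variable {k n : ℕ}

lemma mem_dirEdges {j : Fin n} {p : Grid k n × Grid k n} :
    p ∈ dirEdges k j ↔ (p.2 j : ℕ) = (p.1 j : ℕ) + 1 ∧ ∀ i, i ≠ j → p.1 i = p.2 i := by
  simp [dirEdges]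

lemma dirEdges_injOn_fst (j : Fin n) :
    Set.InjOn Prod.fst (dirEdges k j : Set (Grid k n × Grid k n)) := by
  rintro ⟨x, y⟩ hp ⟨x', y'⟩ hp' h
  obtain ⟨h1, h2⟩ := mem_dirEdges.1 (Finset.mem_coe.1 hp)
  obtain ⟨h1', h2'⟩ := mem_dirEdges.1 (Finset.mem_coe.1 hp')
  simp only at h h1 h2 h1' h2'
  subst h
  refine Prod.ext rfl (funext fun i => ?_)
  rcases eq_or_ne i j with rfl | hi
  · exact Fin.ext (h1.trans h1'.symm)
  · exact (h2 i hi).symm.trans (h2' i hi)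

lemma card_dirEdges_le (j : Fin n) : (dirEdges k j).card ≤ k ^ n := by
  have h := Finset.card_le_card_of_injOn (s := dirEdges k j) (t := Finset.univ) Prod.fst
    (fun _ _ => Finset.mem_coe.2 (Finset.mem_univ _)) (dirEdges_injOn_fst j)
  simpa using h

lemma eq_of_mem_dirEdges {j j' : Fin n} {p : Grid k n × Grid k n} (h : p ∈ dirEdges k j)
    (h' : p ∈ dirEdges k j' ∨ p.swap ∈ dirEdges k j') : j = j' := by
  by_contra hne
  have h1 := (mem_dirEdges.1 h).1
  have h2 : p.1 j = p.2 j := by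
    rcases h' with h' | h'
    · exact (mem_dirEdges.1 h').2 j hne
    · exact ((mem_dirEdges.1 h').2 j hne).symm
  rw [h2] at h1
  omega

lemma gridGraph_adj_iff {x y : Grid k n} :
    (gridGraph k n).Adj x y ↔ ∃ j, (x, y) ∈ dirEdges k j ∨ (y, x) ∈ dirEdges k j := by
  refine exists_congr fun j => ?_
  rw [mem_dirEdges, mem_dirEdges, abs_eq (by norm_num)]
  constructor
  · rintro ⟨h | h, h'⟩
    · exact Or.inl ⟨by simp only; omega, h'⟩
    · exact Or.inr ⟨by simp only; omega, fun i hi => (h' i hi).symm⟩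
  · rintro (⟨h, h'⟩ | ⟨h, h'⟩)
    · exact ⟨Or.inl (by simp only at h; omega), h'⟩
    · exact ⟨Or.inr (by simp only at h; omega), fun i hi => (h' i hi).symm⟩

-- An adjacent pair lies in exactly one direction and one orientation, so the double sum counts it
-- once.
open Classical in
lemma adj_indicator (x y : Grid k n) :
    (if (gridGraph k n).Adj x y then (1 : ℝ) else 0) =
      ∑ j, ((if (x, y) ∈ dirEdges k j then 1 else 0) + if (y, x) ∈ dirEdges k j then 1 else 0) := by
  split_ifs with h
  · obtain ⟨j, hj⟩ := gridGraph_adj_iff.1 h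
    rw [Finset.sum_eq_single j]
    · rcases hj with hj | hj
      · have hn : (y, x) ∉ dirEdges k j := fun h' => by
          have h1 := (mem_dirEdges.1 hj).1
          have h2 := (mem_dirEdges.1 h').1
          simp only at h1 h2
          omega
        simp [hj, hn]
      · have hn : (x, y) ∉ dirEdges k j := fun h' => by
          have h1 := (mem_dirEdges.1 hj).1
          have h2 := (mem_dirEdges.1 h').1
          simp only at h1 h2
          omega
        simp [hj, hn]
    · intro j' _ hj'
      have h1 : (x, y) ∉ dirEdges k j' := fun h' => hj' <| by
        rcases hj with hj | hj
        · exact eq_of_mem_dirEdges h' (Or.inl hj)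
        · exact eq_of_mem_dirEdges h' (Or.inr hj)
      have h2 : (y, x) ∉ dirEdges k j' := fun h' => hj' <| by
        rcases hj with hj | hj
        · exact eq_of_mem_dirEdges h' (Or.inr hj)
        · exact eq_of_mem_dirEdges h' (Or.inl hj)
      simp [h1, h2]
    · simp
  · symm
    refine Finset.sum_eq_zero fun j _ => ?_
    have h1 : (x, y) ∉ dirEdges k j := fun h' => h (gridGraph_adj_iff.2 ⟨j, Or.inl h'⟩)
    have h2 : (y, x) ∉ dirEdges k j := fun h' => h (gridGraph_adj_iff.2 ⟨j, Or.inr h'⟩)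
    simp [h1, h2]

lemma edgeBoundaryCard_eq (A : Finset (Grid k n)) :
    (edgeBoundaryCard A : ℝ) = ∑ j, ∑ p ∈ dirEdges k j,
      |Set.indicator (A : Set (Grid k n)) (1 : Grid k n → ℝ) p.1 -
        Set.indicator (A : Set (Grid k n)) (1 : Grid k n → ℝ) p.2| := by
  classical
  set φ : Grid k n → ℝ := Set.indicator (A : Set (Grid k n)) 1 with hφ
  have hφ' : ∀ x, φ x = if x ∈ A then 1 else 0 := fun x => by simp [hφ, Set.indicator_apply]
  have hcount : (edgeBoundaryCard A : ℝ) = ∑ p : Grid k n × Grid k n,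
      φ p.1 * (1 - φ p.2) * if (gridGraph k n).Adj p.1 p.2 then 1 else 0 := by
    rw [edgeBoundaryCard, Finset.card_eq_sum_ones, SimpleGraph.interedges_def,
      Finset.sum_filter, Finset.sum_product, Nat.cast_sum, Fintype.sum_prod_type,
      ← Finset.sum_filter_add_sum_filter_not Finset.univ (fun x => x ∈ A)]
    have hz : ∑ x with x ∉ A, ∑ y, φ x * (1 - φ y) *
        (if (gridGraph k n).Adj x y then (1 : ℝ) else 0) = 0 :=
      Finset.sum_eq_zero fun x hx => Finset.sum_eq_zero fun y _ => by
        rw [hφ' x, if_neg (Finset.mem_filter.1 hx).2, zero_mul, zero_mul]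
    rw [hz, add_zero, Finset.filter_univ_mem]
    refine Finset.sum_congr rfl fun x hx => ?_
    rw [Nat.cast_sum, ← Finset.sum_add_sum_compl A]
    have hz' : ∑ y ∈ A, φ x * (1 - φ y) *
        (if (gridGraph k n).Adj x y then (1 : ℝ) else 0) = 0 :=
      Finset.sum_eq_zero fun y hy => by
        rw [hφ' y, if_pos hy, sub_self, mul_zero, zero_mul]
    rw [hz', zero_add]
    refine Finset.sum_congr rfl fun y hy => ?_
    rw [hφ' x, if_pos hx, hφ' y, if_neg (Finset.mem_compl.1 hy)]
    simp
  rw [hcount]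
  simp_rw [adj_indicator, Finset.mul_sum, mul_add]
  rw [Finset.sum_comm]
  refine Finset.sum_congr rfl fun j _ => ?_
  rw [Finset.sum_add_distrib]
  have hswap : ∑ p : Grid k n × Grid k n, φ p.1 * (1 - φ p.2) *
      (if (p.2, p.1) ∈ dirEdges k j then (1 : ℝ) else 0) =
      ∑ p : Grid k n × Grid k n, φ p.2 * (1 - φ p.1) * (if p ∈ dirEdges k j then 1 else 0) :=
    Fintype.sum_equiv (Equiv.prodComm _ _) _ _ fun p => rfl
  rw [hswap, ← Finset.sum_add_distrib, ← Finset.sum_subset (Finset.subset_univ (dirEdges k j))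
    fun p _ hp => by simp [hp]]
  refine Finset.sum_congr rfl fun p hp => ?_
  rw [Prod.mk.eta, if_pos hp, hφ' p.1, hφ' p.2]
  split_ifs <;> norm_num

end Edges

/-! ### Total variation along axis-parallel lines. -/

section Lines

variable {k n : ℕ}

/-- The natural number `t`, truncated to an element of `Fin k`. -/
def clamp (k : ℕ) [NeZero k] (t : ℕ) : Fin k :=
  ⟨min t (k - 1), by have := NeZero.pos k; omega⟩

/-- The point with `j`-th coordinate `y` and the remaining coordinates given by `u`. -/
def linePoint (j : Fin n) (u : {i // i ≠ j} → Fin k) (y : Fin k) : Grid k n :=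
  (Equiv.funSplitAt j (Fin k)).symm (y, u)

lemma linePoint_same (j : Fin n) (u : {i // i ≠ j} → Fin k) (y : Fin k) :
    linePoint j u y j = y := by simp [linePoint]

lemma linePoint_of_ne {i j : Fin n} (h : i ≠ j) (u : {i // i ≠ j} → Fin k) (y : Fin k) :
    linePoint j u y i = u ⟨i, h⟩ := by simp [linePoint, h]

/-- The total variation of a function on the path `Fin k`. -/
noncomputable def pathVariation [NeZero k] (φ : Fin k → ℝ) : ℝ :=
  ∑ y ∈ Finset.range (k - 1), |φ (clamp k y) - φ (clamp k (y + 1))|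

lemma pathVariation_nonneg [NeZero k] (φ : Fin k → ℝ) : 0 ≤ pathVariation φ :=
  Finset.sum_nonneg fun _ _ => abs_nonneg _

lemma sum_pathVariation_le [NeZero k] (F : Grid k n → ℝ) (j : Fin n) :
    ∑ u, pathVariation (fun y => F (linePoint j u y)) ≤ ∑ p ∈ dirEdges k j, |F p.1 - F p.2| := by
  simp_rw [pathVariation]
  rw [← Finset.sum_product' Finset.univ (Finset.range (k - 1)) fun u y =>
    |F (linePoint j u (clamp k y)) - F (linePoint j u (clamp k (y + 1)))|]
  set e : ({i // i ≠ j} → Fin k) × ℕ → Grid k n × Grid k n := fun p =>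
    (linePoint j p.1 (clamp k p.2), linePoint j p.1 (clamp k (p.2 + 1))) with he
  have hinj : Set.InjOn e ↑((Finset.univ : Finset ({i // i ≠ j} → Fin k)) ×ˢ
      Finset.range (k - 1)) := by
    rintro ⟨u, y⟩ hp ⟨u', y'⟩ hp' h
    simp only [Finset.coe_product, Set.mem_prod, Finset.mem_coe, Finset.mem_range] at hp hp'
    have h1 := congrArg Prod.fst h
    simp only [he] at h1
    refine Prod.ext (funext fun i => ?_) ?_
    · have h2 := congrFun h1 i
      rwa [linePoint_of_ne i.2, linePoint_of_ne i.2] at h2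
    · have h2 := congrFun h1 j
      rw [linePoint_same, linePoint_same] at h2
      have h3 := congrArg Fin.val h2
      simp only [clamp] at h3
      simp only
      omega
  rw [← Finset.sum_image (g := e) (f := fun p => |F p.1 - F p.2|) hinj]
  refine Finset.sum_le_sum_of_subset_of_nonneg ?_ fun _ _ _ => abs_nonneg _
  intro p hp
  obtain ⟨⟨u, y⟩, hq, rfl⟩ := Finset.mem_image.1 hp
  simp only [Finset.mem_product, Finset.mem_range] at hq
  refine mem_dirEdges.2 ⟨?_, fun i hi => ?_⟩
  · simp only [he, linePoint_same, clamp]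
    omega
  · simp only [he, linePoint_of_ne hi]

end Lines

end GridJunta

/-! ### Binary digits and the map from bit strings to a path. -/

namespace GridJunta

section Digits

variable {m : ℕ}

/-- The number with binary digits `b`. -/
def binaryValue (b : Fin m → Fin 2) : ℕ := (finFunctionFinEquiv b : ℕ)

lemma binaryValue_eq (b : Fin m → Fin 2) : binaryValue b = ∑ i, (b i : ℕ) * 2 ^ (i : ℕ) :=
  finFunctionFinEquiv_apply b

lemma binaryValue_lt (b : Fin m → Fin 2) : binaryValue b < 2 ^ m := (finFunctionFinEquiv b).2

lemma binaryValue_injective : Function.Injective (binaryValue (m := m)) := fun _ _ h =>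
  finFunctionFinEquiv.injective (Fin.ext h)

lemma exists_binaryValue_eq {t : ℕ} (ht : t < 2 ^ m) : ∃ b : Fin m → Fin 2, binaryValue b = t :=
  ⟨finFunctionFinEquiv.symm ⟨t, ht⟩, by simp [binaryValue]⟩

lemma card_binaryValue_mem_le (a c : ℕ) (s : Finset (Fin m → Fin 2))
    (hs : ∀ b ∈ s, a ≤ binaryValue b ∧ binaryValue b < c) : s.card ≤ c - a := by
  rw [← Nat.card_Ico]
  exact Finset.card_le_card_of_injOn binaryValue
    (fun b hb => Finset.mem_coe.2 (Finset.mem_Ico.2 (hs b hb))) binaryValue_injective.injOn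

lemma binaryValue_flip_le (i : Fin m) (b : Fin m → Fin 2) :
    binaryValue (Hypercube.flip i b) ≤ binaryValue b + 2 ^ (i : ℕ) := by
  rw [binaryValue_eq, binaryValue_eq, ← Finset.add_sum_erase _ _ (Finset.mem_univ i),
    ← Finset.add_sum_erase Finset.univ (fun i => (b i : ℕ) * 2 ^ (i : ℕ)) (Finset.mem_univ i)]
  have h : ∑ l ∈ Finset.univ.erase i, (Hypercube.flip i b l : ℕ) * 2 ^ (l : ℕ) =
      ∑ l ∈ Finset.univ.erase i, (b l : ℕ) * 2 ^ (l : ℕ) :=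
    Finset.sum_congr rfl fun l hl => by
      rw [Hypercube.flip_apply_of_ne (Finset.ne_of_mem_erase hl)]
  have h1 : (Hypercube.flip i b i : ℕ) * 2 ^ (i : ℕ) ≤ 2 ^ (i : ℕ) := by
    have : (Hypercube.flip i b i : ℕ) ≤ 1 := by omega
    nlinarith [Nat.zero_le (2 ^ (i : ℕ))]
  rw [h]
  omega

lemma le_binaryValue_flip (i : Fin m) (b : Fin m → Fin 2) :
    binaryValue b ≤ binaryValue (Hypercube.flip i b) + 2 ^ (i : ℕ) := by
  simpa only [Hypercube.flip_flip] using binaryValue_flip_le i (Hypercube.flip i b)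

end Digits

section Path

variable {k m : ℕ} [NeZero k]

lemma clamp_coe (y : Fin k) : clamp k y = y := Fin.ext (by simp only [clamp]; omega)

lemma abs_sub_clamp_le (φ : Fin k → ℝ) (s t : ℕ) :
    |φ (clamp k s) - φ (clamp k t)| ≤ ∑ y ∈ Finset.range (k - 1),
      if (s ≤ y ∧ y < t) ∨ (t ≤ y ∧ y < s) then |φ (clamp k y) - φ (clamp k (y + 1))| else 0 := by
  wlog hst : s ≤ t generalizing s t
  · rw [abs_sub_comm]
    refine (this t s (le_of_not_ge hst)).trans (le_of_eq (Finset.sum_congr rfl fun y _ => ?_))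
    simp only [or_comm]
  have h1 := dist_le_Ico_sum_dist (fun y => φ (clamp k y)) hst
  simp only [Real.dist_eq] at h1
  refine h1.trans ?_
  rw [← Finset.sum_filter]
  -- Past `k - 1` the truncation is constant, so those steps contribute nothing.
  have hsub : ∑ y ∈ Finset.Ico s t, |φ (clamp k y) - φ (clamp k (y + 1))| =
      ∑ y ∈ (Finset.Ico s t).filter (· < k - 1), |φ (clamp k y) - φ (clamp k (y + 1))| := by
    rw [Finset.sum_filter]
    refine Finset.sum_congr rfl fun y _ => ?_
    split_ifs with h
    · rfl
    · have : clamp k y = clamp k (y + 1) := Fin.ext (by simp only [clamp]; omega)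
      rw [this, sub_self, abs_zero]
  rw [hsub]
  refine Finset.sum_le_sum_of_subset_of_nonneg (fun y hy => ?_) fun _ _ _ => abs_nonneg _
  simp only [Finset.mem_filter, Finset.mem_Ico, Finset.mem_range] at hy ⊢
  omega

/-- A flip of bit `i` crosses the edge from `y` to `y + 1` only if the binary value is within `2 ^
i` of the threshold `(y + 1) * q`, which leaves at most `2 * 2 ^ i` strings. -/
lemma sum_abs_sub_flip_le {q : ℕ} (hq : 0 < q) (φ : Fin k → ℝ) (i : Fin m) :
    ∑ b, |φ (clamp k (binaryValue b / q)) - φ (clamp k (binaryValue (Hypercube.flip i b) / q))| ≤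
      2 * 2 ^ (i : ℕ) * pathVariation φ := by
  refine (Finset.sum_le_sum fun b _ => abs_sub_clamp_le φ _ _).trans ?_
  rw [Finset.sum_comm, pathVariation, Finset.mul_sum]
  refine Finset.sum_le_sum fun y _ => ?_
  rw [← Finset.sum_filter, Finset.sum_const, nsmul_eq_mul]
  refine mul_le_mul_of_nonneg_right ?_ (abs_nonneg _)
  have h := card_binaryValue_mem_le ((y + 1) * q - 2 ^ (i : ℕ)) ((y + 1) * q + 2 ^ (i : ℕ))
    {b : Fin m → Fin 2 | (binaryValue b / q ≤ y ∧ y < binaryValue (Hypercube.flip i b) / q) ∨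
      (binaryValue (Hypercube.flip i b) / q ≤ y ∧ y < binaryValue b / q)} (fun b hb => by
      have h1 := binaryValue_flip_le i b
      have h2 := le_binaryValue_flip i b
      rcases (Finset.mem_filter.1 hb).2 with ⟨h3, h4⟩ | ⟨h3, h4⟩
      · have h5 := (Nat.div_lt_iff_lt_mul hq).1 (Nat.lt_succ_of_le h3)
        have h6 := (Nat.le_div_iff_mul_le hq).1 (Nat.succ_le_of_lt h4)
        simp only [Nat.succ_eq_add_one] at h5 h6
        omega
      · have h5 := (Nat.div_lt_iff_lt_mul hq).1 (Nat.lt_succ_of_le h3)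
        have h6 := (Nat.le_div_iff_mul_le hq).1 (Nat.succ_le_of_lt h4)
        simp only [Nat.succ_eq_add_one] at h5 h6
        omega)
  have h' : (y + 1) * q + 2 ^ (i : ℕ) - ((y + 1) * q - 2 ^ (i : ℕ)) ≤ 2 * 2 ^ (i : ℕ) := by omega
  exact_mod_cast h.trans h'

/-- Each fibre is an interval of `q` values, except that the last one also absorbs the at most `k`
values left over from the division. -/
lemma card_clamp_fiber_le {q : ℕ} (hq : 0 < q) (hqk : 2 ^ m ≤ k * q + k) (y : Fin k) :
    (Finset.univ.filter fun b : Fin m → Fin 2 => clamp k (binaryValue b / q) = y).card ≤ q + k := by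
  refine (card_binaryValue_mem_le ((y : ℕ) * q) ((y : ℕ) * q + (q + k)) _ fun b hb => ?_).trans
    (by omega)
  have h := congrArg Fin.val (Finset.mem_filter.1 hb).2
  simp only [clamp] at h
  have hb' := binaryValue_lt b
  constructor
  · exact (Nat.le_div_iff_mul_le hq).1 (by omega)
  · rcases le_or_gt (binaryValue b / q) (k - 1) with h1 | h1
    · rw [min_eq_left h1] at h
      have := (Nat.div_lt_iff_lt_mul hq).1 (Nat.lt_succ_of_le h.le)
      rw [Nat.succ_eq_add_one, add_mul] at this
      omega
    · rw [min_eq_right h1.le] at h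
      have hk := NeZero.pos k
      have hk' : k = (y : ℕ) + 1 := by omega
      have : k * q = (y : ℕ) * q + q := by nth_rewrite 1 [hk']; ring
      omega

end Path

lemma sum_comp_le {κ α β : Type*} [Fintype κ] [DecidableEq κ] [Fintype α] [Fintype β] [DecidableEq β]
    (π : α → β) {Q : ℕ} (hQ : ∀ b, (Finset.univ.filter fun a => π a = b).card ≤ Q)
    (V : (κ → β) → ℝ) (hV : ∀ u, 0 ≤ V u) :
    ∑ r : κ → α, V (fun l => π (r l)) ≤ (Q : ℝ) ^ Fintype.card κ * ∑ u, V u := by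
  classical
  rw [← Finset.sum_fiberwise Finset.univ (fun (r : κ → α) l => π (r l)), Finset.mul_sum]
  refine Finset.sum_le_sum fun u _ => ?_
  have h : ∑ r : κ → α with (fun l => π (r l)) = u, V (fun l => π (r l)) =
      (Finset.univ.filter fun r : κ → α => (fun l => π (r l)) = u).card * V u := by
    rw [← nsmul_eq_mul, ← Finset.sum_const]
    exact Finset.sum_congr rfl fun r hr => by rw [(Finset.mem_filter.1 hr).2]
  rw [h]
  refine mul_le_mul_of_nonneg_right ?_ (hV u)
  have hpi : (Finset.univ.filter fun r : κ → α => (fun l => π (r l)) = u) =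
      Fintype.piFinset fun l => Finset.univ.filter fun a => π a = u l := by
    ext r
    simp [funext_iff]
  rw [hpi, Fintype.card_piFinset]
  have := Finset.prod_le_pow_card Finset.univ
    (fun l => (Finset.univ.filter fun a => π a = u l).card) Q fun l _ => hQ _
  rw [Finset.card_univ] at this
  exact_mod_cast this

/-! ### Transfer of the junta theorem from the cube to the grid. -/

section Transfer

variable {k n m : ℕ} [NeZero k]

/-- The point of the grid obtained from blocks of binary digits, each block being divided by `q` and
truncated. -/
def ofDigits (k q : ℕ) [NeZero k] (x : Fin n × Fin m → Fin 2) : Grid k n := fun j =>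
  clamp k (binaryValue (fun i => x (j, i)) / q)

/-- With the other blocks fixed, block `j` moves along one line, where the path bound applies; each
line arises from at most `(q + k) ^ (n - 1)` choices of those blocks. -/
lemma sum_flip_ofDigits_le {q : ℕ} (hq : 0 < q) (hqk : 2 ^ m ≤ k * q + k) (F : Grid k n → ℝ)
    (j : Fin n) (i : Fin m) :
    ∑ x : Fin n × Fin m → Fin 2, |F (ofDigits k q x) - F (ofDigits k q (Hypercube.flip (j, i) x))| ≤
      2 * 2 ^ (i : ℕ) * ((q + k : ℕ) : ℝ) ^ (n - 1) * ∑ p ∈ dirEdges k j, |F p.1 - F p.2| := by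
  set T := Fin m → Fin 2 with hT
  set π : T → Fin k := fun b => clamp k (binaryValue b / q) with hπ
  set e : (Fin n × Fin m → Fin 2) ≃ T × ({l // l ≠ j} → T) :=
    (Equiv.curry (Fin n) (Fin m) (Fin 2)).trans (Equiv.funSplitAt j T) with he
  have hpt : ∀ x, ofDigits k q x = linePoint j (fun l => π ((e x).2 l)) (π (e x).1) := fun x => by
    funext l
    rcases eq_or_ne l j with rfl | hl
    · rw [linePoint_same]; rfl
    · rw [linePoint_of_ne hl]; rfl
  have hflip1 : ∀ x, (e (Hypercube.flip (j, i) x)).1 = Hypercube.flip i (e x).1 := fun x => by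
    funext i'
    change Hypercube.flip (j, i) x (j, i') = Hypercube.flip i (fun i => x (j, i)) i'
    rcases eq_or_ne i' i with rfl | hi
    · rw [Hypercube.flip_apply_same, Hypercube.flip_apply_same]
    · rw [Hypercube.flip_apply_of_ne hi, Hypercube.flip_apply_of_ne (by simpa using hi)]
  have hflip2 : ∀ x, (e (Hypercube.flip (j, i) x)).2 = (e x).2 := fun x => by
    funext l i'
    exact Hypercube.flip_apply_of_ne (fun h => l.2 (congrArg Prod.fst h)) x
  have hsum : ∑ x : Fin n × Fin m → Fin 2,
      |F (ofDigits k q x) - F (ofDigits k q (Hypercube.flip (j, i) x))| =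
      ∑ p : T × ({l // l ≠ j} → T), |F (linePoint j (fun l => π (p.2 l)) (π p.1)) -
        F (linePoint j (fun l => π (p.2 l)) (π (Hypercube.flip i p.1)))| :=
    Fintype.sum_equiv e _ _ fun x => by rw [hpt, hpt, hflip1, hflip2]
  rw [hsum, Fintype.sum_prod_type_right]
  have hcard : Fintype.card {l // l ≠ j} = n - 1 := by simp
  calc _ ≤ ∑ r : {l // l ≠ j} → T, 2 * 2 ^ (i : ℕ) *
        pathVariation (fun y => F (linePoint j (fun l => π (r l)) y)) :=
        Finset.sum_le_sum fun r _ =>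
          sum_abs_sub_flip_le hq (fun y => F (linePoint j (fun l => π (r l)) y)) i
    _ = 2 * 2 ^ (i : ℕ) * ∑ r : {l // l ≠ j} → T,
        pathVariation (fun y => F (linePoint j (fun l => π (r l)) y)) := by rw [Finset.mul_sum]
    _ ≤ 2 * 2 ^ (i : ℕ) * (((q + k : ℕ) : ℝ) ^ (n - 1) *
        ∑ u, pathVariation (fun y => F (linePoint j u y))) := by
        refine mul_le_mul_of_nonneg_left ?_ (by positivity)
        rw [← hcard]
        exact sum_comp_le π (card_clamp_fiber_le hq hqk)
          (fun u => pathVariation (fun y => F (linePoint j u y))) fun u => pathVariation_nonneg _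
    _ ≤ 2 * 2 ^ (i : ℕ) * (((q + k : ℕ) : ℝ) ^ (n - 1) *
        ∑ p ∈ dirEdges k j, |F p.1 - F p.2|) := by
        gcongr
        exact sum_pathVariation_le F j
    _ = _ := by ring

lemma sum_influence_ofDigits_le {q : ℕ} (hq : 0 < q) (hqk : 2 ^ m ≤ k * q + k)
    (F : Grid k n → ℝ) :
    ∑ p : Fin n × Fin m, Hypercube.influence (fun x => F (ofDigits k q x)) p ≤
      2 * 2 ^ m * ((q + k : ℕ) : ℝ) ^ (n - 1) * (∑ j, ∑ p ∈ dirEdges k j, |F p.1 - F p.2|) /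
        (2 ^ m) ^ n := by
  have hcard : (Fintype.card (Fin n × Fin m → Fin 2) : ℝ) = (2 ^ m) ^ n := by
    simp [← pow_mul, mul_comm]
  have hgeom : ∑ i : Fin m, (2 : ℝ) ^ (i : ℕ) ≤ 2 ^ m := by
    rw [Fin.sum_univ_eq_sum_range (fun i => (2 : ℝ) ^ i), geom_sum_eq (by norm_num)]
    norm_num
  simp_rw [Hypercube.influence, Fintype.expect_eq_sum_div_card, hcard]
  rw [← Finset.sum_div]
  refine div_le_div_of_nonneg_right ?_ (by positivity)
  rw [Fintype.sum_prod_type, Finset.mul_sum]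
  refine Finset.sum_le_sum fun j _ => ?_
  refine (Finset.sum_le_sum fun i _ => sum_flip_ofDigits_le hq hqk F j i).trans ?_
  rw [← Finset.sum_mul, ← Finset.sum_mul, ← Finset.mul_sum]
  have : 0 ≤ ∑ p ∈ dirEdges k j, |F p.1 - F p.2| := Finset.sum_nonneg fun _ _ => abs_nonneg _
  gcongr

/-- A function on the cube that approximates `F ∘ ofDigits` can be restricted to a section of
`ofDigits` of product form on which it approximates `F` almost as well. -/
lemma exists_section {q : ℕ} (hq : 0 < q) (hqk : k * q ≤ 2 ^ m) (F : Grid k n → ℝ)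
    (G : (Fin n × Fin m → Fin 2) → ℝ) :
    ∃ σ : Fin n → Fin k → Fin m → Fin 2,
      (q : ℝ) ^ n * ∑ y : Grid k n, |F y - G (fun p => σ p.1 (y p.1) p.2)| ≤
        ∑ x, |F (ofDigits k q x) - G x| := by
  have : NeZero q := ⟨hq.ne'⟩
  have hlt : ∀ (y : Fin k) (c : Fin q), (y : ℕ) * q + c < 2 ^ m := fun y c => by
    have : ((y : ℕ) + 1) * q ≤ k * q := Nat.mul_le_mul_right q y.2
    have := c.2
    rw [add_mul] at *
    omega
  choose D hD using fun (y : Fin k) (c : Fin q) => exists_binaryValue_eq (hlt y c)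
  -- Block `j` encodes `y j * q + c j`. The offsets `c` index disjoint sections of `ofDigits`, and
  -- the best one does at least as well as the average.
  set e : (Fin n → Fin q) × Grid k n → (Fin n × Fin m → Fin 2) := fun p l =>
    D (p.2 l.1) (p.1 l.1) l.2 with he
  have hdiv : ∀ (y : Fin k) (c : Fin q), ((y : ℕ) * q + c) / q = y := fun y c => by
    rw [mul_comm, Nat.mul_add_div hq, Nat.div_eq_of_lt c.2, add_zero]
  have hof : ∀ p, ofDigits k q (e p) = p.2 := fun p => by
    funext j
    change clamp k (binaryValue (D (p.2 j) (p.1 j)) / q) = p.2 j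
    rw [hD, hdiv, clamp_coe]
  have hinj : Function.Injective e := fun p p' h => by
    have h2 : p.2 = p'.2 := by rw [← hof p, ← hof p', h]
    refine Prod.ext (funext fun j => ?_) h2
    have h3 : D (p.2 j) (p.1 j) = D (p'.2 j) (p'.1 j) := funext fun i => congrFun h (j, i)
    have h4 := congrArg binaryValue h3
    rw [hD, hD, h2] at h4
    exact Fin.ext (by omega)
  have hle : ∑ c : Fin n → Fin q, ∑ y : Grid k n, |F y - G (e (c, y))| ≤
      ∑ x, |F (ofDigits k q x) - G x| := by
    rw [← Fintype.sum_prod_type' fun c y => |F y - G (e (c, y))|]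
    calc _ = ∑ p, |F (ofDigits k q (e p)) - G (e p)| :=
          Finset.sum_congr rfl fun p _ => by rw [hof]
      _ = ∑ x ∈ Finset.univ.image e, |F (ofDigits k q x) - G x| :=
          (Finset.sum_image hinj.injOn (f := fun x => |F (ofDigits k q x) - G x|)).symm
      _ ≤ _ := Finset.sum_le_sum_of_subset_of_nonneg (Finset.subset_univ _)
          fun _ _ _ => abs_nonneg _
  obtain ⟨c, -, hc⟩ := Finset.exists_min_image Finset.univ
    (fun c : Fin n → Fin q => ∑ y : Grid k n, |F y - G (e (c, y))|) Finset.univ_nonempty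
  refine ⟨fun j y => D y (c j), le_trans ?_ hle⟩
  have := Finset.card_nsmul_le_sum Finset.univ
    (fun c : Fin n → Fin q => ∑ y : Grid k n, |F y - G (e (c, y))|) _ fun c' _ => hc c'
      (Finset.mem_univ _)
  simpa [nsmul_eq_mul] using this

/-- The junta theorem for subsets of the `ℓ¹`-grid. -/
theorem booleanJuntaConstant : BooleanJuntaConstant 80 := by
  intro k n hk hn A ε hε
  have : NeZero k := ⟨by omega⟩
  set F : Grid k n → ℝ := Set.indicator (A : Set (Grid k n)) 1 with hF
  have hF01 : ∀ x, F x = 0 ∨ F x = 1 := fun x => by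
    by_cases hx : x ∈ A <;> simp [hF, hx]
  -- Large enough that `2 ^ m ≥ 4 * k ^ 2 * n`, which keeps both rounding losses, `hup` and `hlow`,
  -- within a factor `2`.
  set m := 4 * k ^ 2 * n with hm
  set q := 2 ^ m / k with hq
  have hLbig : 4 * k ^ 2 * n ≤ 2 ^ m := hm ▸ Nat.lt_two_pow_self.le
  have hkL : k ≤ 2 ^ m := by nlinarith [Nat.mul_le_mul hk hn]
  have hq0 : 0 < q := Nat.div_pos hkL (by omega)
  have hqk1 : k * q ≤ 2 ^ m := Nat.mul_div_le _ _
  have hqk2 : 2 ^ m ≤ k * q + k := by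
    have := Nat.lt_mul_div_succ (2 ^ m) (show 0 < k by omega)
    rw [← hq, mul_add, mul_one] at this
    exact this.le
  set L : ℝ := 2 ^ m with hL
  have hL0 : 0 < L := by positivity
  have hk1 : (1 : ℝ) ≤ k := by exact_mod_cast hk
  have hn1 : (1 : ℝ) ≤ n := by exact_mod_cast hn
  have hq1 : (1 : ℝ) ≤ q := by exact_mod_cast hq0
  have hLbig' : 4 * (k : ℝ) ^ 2 * n ≤ L := by rw [hL]; exact_mod_cast hLbig
  have hqk1' : (k : ℝ) * q ≤ L := by rw [hL]; exact_mod_cast hqk1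
  have hqk2' : L ≤ k * q + k := by rw [hL]; exact_mod_cast hqk2
  set E : ℝ := (edgeBoundaryCard A : ℝ) with hE
  have hE0 : 0 ≤ E := by positivity
  have hEeq := edgeBoundaryCard_eq A
  rw [← hF, ← hE] at hEeq
  have hinf := sum_influence_ofDigits_le (m := m) hq0 hqk2 F
  rw [← hEeq, ← hL] at hinf
  have hup : ((k : ℝ) * (q + k) / L) ^ (n - 1) ≤ 2 := by
    have h1 : (k : ℝ) * (q + k) / L ≤ Real.exp (1 / (4 * n)) := by
      have h2 : (k : ℝ) * (q + k) / L ≤ 1 + 1 / (4 * n) := by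
        rw [div_le_iff₀ hL0, add_mul, one_mul]
        have : (k : ℝ) ^ 2 ≤ 1 / (4 * n) * L := by
          rw [div_mul_eq_mul_div, one_mul, le_div_iff₀ (by positivity)]
          linarith
        nlinarith
      linarith [Real.add_one_le_exp (1 / (4 * (n : ℝ)))]
    calc ((k : ℝ) * (q + k) / L) ^ (n - 1) ≤ Real.exp (1 / (4 * n)) ^ (n - 1) := by gcongr
      _ ≤ Real.exp (1 / (4 * n)) ^ n := by
        refine pow_le_pow_right₀ (Real.one_le_exp (by positivity)) (by omega)
      _ = Real.exp (1 / 4) := by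
        rw [← Real.exp_nat_mul]; congr 1; field_simp
      _ ≤ 2 := by
        have h2 : Real.exp (1 / 4) ^ 4 ≤ 2 ^ 4 := by
          rw [← Real.exp_nat_mul]
          norm_num
          linarith [Real.exp_one_lt_d9]
        exact le_of_pow_le_pow_left₀ (by norm_num) (by norm_num) h2
  have hI : 2 * L * ((q + k : ℕ) : ℝ) ^ (n - 1) * E / L ^ n ≤ 4 * E / (k : ℝ) ^ (n - 1) := by
    have hLn : L ^ n = L * L ^ (n - 1) := by rw [← pow_succ']; congr 1; omega
    have : 2 * L * ((q + k : ℕ) : ℝ) ^ (n - 1) * E / L ^ n =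
        2 * E * ((k : ℝ) * (q + k) / L) ^ (n - 1) / (k : ℝ) ^ (n - 1) := by
      rw [hLn, div_pow, mul_pow]
      push_cast
      field_simp
    rw [this]
    refine div_le_div_of_nonneg_right ?_ (by positivity)
    nlinarith
  have hlow : 1 / 2 ≤ ((k : ℝ) * q / L) ^ n := by
    have h1 : -(1 / (2 * n) : ℝ) ≤ -(k / L) := by
      rw [neg_le_neg_iff, div_le_div_iff₀ hL0 (by positivity)]
      nlinarith [mul_nonneg (sub_nonneg.2 hk1) (by positivity : (0 : ℝ) ≤ k * n)]
    have h3 : 1 + -(1 / (2 * n) : ℝ) ≤ (k : ℝ) * q / L := by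
      have : 1 - (k : ℝ) / L ≤ (k : ℝ) * q / L := by
        rw [sub_le_iff_le_add, ← add_div, le_div_iff₀ hL0]
        linarith
      linarith
    have h5 : 1 / (2 * (n : ℝ)) ≤ 1 / 2 := by
      apply one_div_le_one_div_of_le <;> linarith
    have h4 := one_add_mul_le_pow (a := -(1 / (2 * n) : ℝ)) (by linarith) n
    calc (1 / 2 : ℝ) = 1 + n * (-(1 / (2 * n) : ℝ)) := by field_simp; norm_num
      _ ≤ (1 + -(1 / (2 * n) : ℝ)) ^ n := h4
      _ ≤ _ := by
        refine pow_le_pow_left₀ (by linarith) h3 n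
  -- Accuracy `ε / 2` pays for the factor `2` lost on the section; the constant is `80 = 10 * 4 *
  -- 2`.
  obtain ⟨J, g, hg01, hgdep, hgclose, hJ⟩ := Hypercube.exists_junta
    (f := fun x => F (ofDigits k q x)) (fun x => hF01 _) (hinf.trans hI) (half_pos hε)
  obtain ⟨σ, hσ⟩ := exists_section hq0 hqk1 F g
  set h : Grid k n → Fin 2 := fun y => if g (fun p => σ p.1 (y p.1) p.2) = 1 then 1 else 0 with hh
  have hhg : ∀ y, toReal h y = g (fun p => σ p.1 (y p.1) p.2) := fun y => by
    rcases hg01 (fun p => σ p.1 (y p.1) p.2) with h0 | h0 <;> simp [toReal, hh, h0]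
  refine ⟨(J.image Prod.fst).card, h, ⟨J.image Prod.fst, rfl, fun x y hxy => ?_⟩, ?_, ?_⟩
  · have : g (fun p => σ p.1 (x p.1) p.2) = g (fun p => σ p.1 (y p.1) p.2) :=
      hgdep fun p hp => by
        rw [hxy p.1 (Finset.mem_coe.2 (Finset.mem_image_of_mem _ (Finset.mem_coe.1 hp)))]
    simp only [hh, this]
  · have hcard : (Fintype.card (Fin n × Fin m → Fin 2) : ℝ) = L ^ n := by
      simp [hL, ← pow_mul, mul_comm]
    rw [Fintype.expect_eq_sum_div_card, hcard, div_le_iff₀ (by positivity)] at hgclose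
    rw [IsClose, Fintype.expect_eq_sum_div_card]
    simp_rw [hhg]
    have hcard' : (Fintype.card (Grid k n) : ℝ) = (k : ℝ) ^ n := by simp
    rw [hcard', div_le_iff₀ (by positivity)]
    rw [div_pow, le_div_iff₀ (by positivity), mul_pow] at hlow
    have h1 := hσ.trans hgclose
    have h2 : ε / 2 * L ^ n ≤ (q : ℝ) ^ n * (ε * (k : ℝ) ^ n) := by nlinarith
    exact le_of_mul_le_mul_left (h1.trans h2) (by positivity)
  · refine le_trans (by exact_mod_cast Finset.card_image_le) (hJ.trans (le_of_eq ?_))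
    congr 1
    field_simp
    ring

end Transfer

end GridJunta

/-! ### From sets to `[l]`-valued functions by superlevel sets. -/

namespace GridJunta

/-- Needed to compare exponents later. For one point of the two-point path, a negative `C` would
force a constant `g`, whose error is at least `1 / 2`. -/
lemma BooleanJuntaConstant.nonneg {C : ℝ} (h : BooleanJuntaConstant C) : 0 ≤ C := by
  by_contra! hC
  set A : Finset (Grid 2 1) := {fun _ => 0} with hA
  obtain ⟨M, g, ⟨J, hJ, hg⟩, hclose, hM⟩ := h 2 1 (by norm_num) le_rfl A (1 / 4) (by norm_num)
  have hb : 0 < edgeBoundaryCard A := by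
    classical
    rw [edgeBoundaryCard, Finset.card_pos]
    refine ⟨(fun _ => 0, fun _ => 1), (SimpleGraph.mem_interedges_iff _).2 ⟨by simp [hA], ?_, ?_⟩⟩
    · rw [Finset.mem_compl, hA, Finset.mem_singleton]
      exact fun h => absurd (congrFun h 0) (by decide)
    · exact ⟨0, by simp, fun i hi => absurd (Subsingleton.elim i 0) hi⟩
  have hM1 : (M : ℝ) < 1 := hM.trans_lt <| by
    rw [Real.exp_lt_one_iff]
    refine div_neg_of_neg_of_pos (mul_neg_of_neg_of_pos hC (by exact_mod_cast hb)) (by norm_num)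
  have hM0 : M = 0 := Nat.lt_one_iff.1 (by exact_mod_cast hM1)
  have hJ0 : J = ∅ := Finset.card_eq_zero.1 (hJ.trans hM0)
  have hconst : g (fun _ => 1) = g fun _ => 0 := hg fun i hi => by simp [hJ0] at hi
  rw [IsClose, Fintype.expect_eq_sum_div_card] at hclose
  have hcard : (Fintype.card (Grid 2 1) : ℝ) = 2 := by simp
  have hsum : ∑ x : Grid 2 1, |Set.indicator (A : Set (Grid 2 1)) (1 : Grid 2 1 → ℝ) x - toReal g x| =
      |1 - toReal g fun _ => 0| + |0 - toReal g fun _ => 0| := by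
    rw [Fintype.sum_equiv (Equiv.funUnique (Fin 1) (Fin 2)) _
      (fun a => |Set.indicator (A : Set (Grid 2 1)) (1 : Grid 2 1 → ℝ) (fun _ => a) -
        toReal g fun _ => a|) fun x => by
          have : x = fun _ => x 0 := funext fun i => by rw [Subsingleton.elim i 0]
          rw [this]; rfl, Fin.sum_univ_two]
    have h1 : (fun _ => 1 : Grid 2 1) ∉ A := by
      rw [hA, Finset.mem_singleton]
      exact fun h => absurd (congrFun h 0) (by decide)
    have h0 : (fun _ => 0 : Grid 2 1) ∈ A := Finset.mem_singleton_self _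
    rw [Set.indicator_of_mem (Finset.mem_coe.2 h0), Set.indicator_of_notMem (by simpa using h1)]
    simp only [toReal, hconst, Pi.one_apply]
  rw [hsum, hcard] at hclose
  have := abs_sub_le 1 (toReal g fun _ => 0) 0
  rw [abs_sub_comm (toReal g fun _ => 0) 0] at this
  norm_num at this hclose
  linarith

/-- The layer-cake decomposition of the distance of two natural numbers. -/
lemma abs_sub_eq_sum_range {N a b : ℕ} (ha : a ≤ N) (hb : b ≤ N) :
    |(a : ℝ) - b| = ∑ t ∈ Finset.range N,
      |(if t < a then (1 : ℝ) else 0) - if t < b then (1 : ℝ) else 0| := by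
  wlog hab : a ≤ b generalizing a b
  · rw [abs_sub_comm, this hb ha (le_of_not_ge hab)]
    exact Finset.sum_congr rfl fun t _ => abs_sub_comm _ _
  have h : ∀ t ∈ Finset.range N, |(if t < a then (1 : ℝ) else 0) - if t < b then (1 : ℝ) else 0| =
      if t ∈ Finset.Ico a b then 1 else 0 := fun t _ => by
    simp only [Finset.mem_Ico]
    split_ifs <;> first | omega | norm_num
  have hsub : Finset.range N ∩ Finset.Ico a b = Finset.Ico a b :=
    Finset.inter_eq_right.2 fun t ht => by
      simp only [Finset.mem_Ico, Finset.mem_range] at ht ⊢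
      omega
  rw [Finset.sum_congr rfl h, Finset.sum_ite_mem, hsub, abs_sub_comm, ← Nat.cast_sub hab,
    Nat.abs_cast]
  simp

section Levels

variable {k n l : ℕ}

/-- The superlevel set of a function on the grid. -/
def superlevel (f : Grid k n → Fin l) (t : ℕ) : Finset (Grid k n) := {x | t < (f x : ℕ)}

lemma indicator_superlevel (f : Grid k n → Fin l) (t : ℕ) (x : Grid k n) :
    Set.indicator (superlevel f t : Set (Grid k n)) (1 : Grid k n → ℝ) x =
      if t < (f x : ℕ) then 1 else 0 := by
  simp [Set.indicator_apply, superlevel]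

lemma toReal_eq_sum (f : Grid k n → Fin l) (x : Grid k n) :
    toReal f x = ∑ t ∈ Finset.range (l - 1),
      Set.indicator (superlevel f t : Set (Grid k n)) (1 : Grid k n → ℝ) x := by
  simp_rw [indicator_superlevel]
  have h := abs_sub_eq_sum_range (N := l - 1) (a := f x) (b := 0) (by omega) (Nat.zero_le _)
  simp only [Nat.cast_zero, sub_zero, Nat.not_lt_zero, if_false, Nat.abs_cast] at h
  rw [toReal, h]
  exact Finset.sum_congr rfl fun t _ => by split_ifs <;> simp

lemma sum_edgeBoundaryCard_superlevel_le (f : Grid k n → Fin l) :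
    ∑ t ∈ Finset.range (l - 1), (edgeBoundaryCard (superlevel f t) : ℝ) ≤
      (k : ℝ) ^ n * sumEdgeDiff (toReal f) := by
  simp_rw [edgeBoundaryCard_eq]
  rw [Finset.sum_comm, sumEdgeDiff, Finset.mul_sum]
  refine Finset.sum_le_sum fun j _ => ?_
  rw [Finset.sum_comm]
  have h : ∀ p ∈ dirEdges k j, ∑ t ∈ Finset.range (l - 1),
      |Set.indicator (superlevel f t : Set (Grid k n)) (1 : Grid k n → ℝ) p.1 -
        Set.indicator (superlevel f t : Set (Grid k n)) (1 : Grid k n → ℝ) p.2| =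
      |toReal f p.1 - toReal f p.2| := fun p _ => by
    simp_rw [indicator_superlevel]
    exact (abs_sub_eq_sum_range (by omega) (by omega)).symm
  rw [Finset.sum_congr rfl h, ← Finset.card_mul_expect]
  exact mul_le_mul_of_nonneg_right (by exact_mod_cast card_dirEdges_le j)
    (Finset.expect_nonneg fun _ _ => abs_nonneg _)

lemma sumEdgeDiff_nonneg (F : Grid k n → ℝ) : 0 ≤ sumEdgeDiff F :=
  Finset.sum_nonneg fun _ _ => Finset.expect_nonneg fun _ _ => abs_nonneg _

end Levels

/-- The junta theorem for sets implies the one for functions with finitely many values. -/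
theorem BooleanJuntaConstant.sumJuntaConstant {C : ℝ} (h : BooleanJuntaConstant C) :
    SumJuntaConstant (2 * C) := by
  intro k n l hk hn hl f B hB ε hε
  have hC := h.nonneg
  have hB0 : 0 ≤ B := (sumEdgeDiff_nonneg _).trans hB
  have hk0 : (0 : ℝ) < k := by exact_mod_cast hk
  have hl0 : (0 : ℝ) < l := by exact_mod_cast hl
  set b : ℕ → ℝ := fun t => (edgeBoundaryCard (superlevel f t) : ℝ) with hb
  have hb0 : ∀ t, 0 ≤ b t := fun t => Nat.cast_nonneg _
  set S : ℝ := (k : ℝ) ^ n * B with hS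
  have hS0 : 0 ≤ S := by positivity
  have hbS : ∑ t ∈ Finset.range (l - 1), b t ≤ S :=
    (sum_edgeBoundaryCard_superlevel_le f).trans (by rw [hS]; gcongr)
  -- The first share equalises the exponents; the second keeps `δ t` positive when `b t = 0`, and
  -- also when `S = 0`, where the quotient is `0`.
  set δ : ℕ → ℝ := fun t => ε / 2 * (b t / S + 1 / l) with hδ
  have hδ0 : ∀ t, 0 < δ t := fun t => by
    have := hb0 t
    positivity
  choose M g hg hclose hM using fun t => h k n hk hn (superlevel f t) (δ t) (hδ0 t)
  choose J hJ hdep using hg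
  have hlt : ∀ x, ∑ t ∈ Finset.range (l - 1), (g t x : ℕ) < l := fun x => by
    have := Finset.sum_le_card_nsmul (Finset.range (l - 1)) (fun t => (g t x : ℕ)) 1
      fun t _ => by omega
    simp only [Finset.card_range, smul_eq_mul, mul_one] at this
    omega
  refine ⟨((Finset.range (l - 1)).biUnion J).card,
    fun x => ⟨∑ t ∈ Finset.range (l - 1), (g t x : ℕ), hlt x⟩, ⟨_, rfl, fun x y hxy => ?_⟩, ?_, ?_⟩
  · rw [Fin.mk.injEq]
    refine Finset.sum_congr rfl fun t ht => ?_
    rw [hdep t fun i hi => hxy i (Finset.mem_coe.2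
      (Finset.mem_biUnion.2 ⟨t, ht, Finset.mem_coe.1 hi⟩))]
  · have hpt : ∀ x, |toReal f x - toReal (fun x => (⟨∑ t ∈ Finset.range (l - 1), (g t x : ℕ),
        hlt x⟩ : Fin l)) x| ≤ ∑ t ∈ Finset.range (l - 1),
          |Set.indicator (superlevel f t : Set (Grid k n)) (1 : Grid k n → ℝ) x -
            toReal (g t) x| := fun x => by
      rw [toReal_eq_sum f, toReal]
      simp only [Nat.cast_sum]
      rw [← Finset.sum_sub_distrib]
      exact Finset.abs_sum_le_sum_abs _ _
    have hδsum : ∑ t ∈ Finset.range (l - 1), δ t ≤ ε := by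
      rw [hδ, ← Finset.mul_sum, Finset.sum_add_distrib, ← Finset.sum_div, Finset.sum_const,
        Finset.card_range, nsmul_eq_mul]
      have h1 : (∑ t ∈ Finset.range (l - 1), b t) / S ≤ 1 := div_le_one_of_le₀ hbS hS0
      have h2 : ((l - 1 : ℕ) : ℝ) * (1 / l) ≤ 1 := by
        rw [mul_one_div]
        exact div_le_one_of_le₀ (by exact_mod_cast Nat.sub_le l 1) hl0.le
      nlinarith
    refine (Finset.expect_le_expect fun x _ => hpt x).trans ?_
    rw [Finset.expect_sum_comm]
    exact (Finset.sum_le_sum fun t _ => hclose t).trans hδsum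
  · have hexp : ∀ t ∈ Finset.range (l - 1), (M t : ℝ) ≤ Real.exp (2 * C * B * k / ε) := by
      intro t ht
      refine (hM t).trans (Real.exp_le_exp.2 ?_)
      have hbt : b t ≤ S := (Finset.single_le_sum (fun t _ => hb0 t) ht).trans hbS
      -- The factor `2` in `2 * C` arises here, from giving only half of `ε` to the proportional
      -- share.
      have hbδ : b t * ε ≤ 2 * S * δ t := by
        rcases hS0.eq_or_lt with h0 | h0
        · have : b t = 0 := le_antisymm (by rwa [← h0] at hbt) (hb0 t)
          rw [this, ← h0]
          simp
        · have : 2 * S * δ t = b t * ε + S * ε / l := by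
            rw [hδ]
            field_simp
          rw [this]
          have : 0 ≤ S * ε / l := by positivity
          linarith
      have hKn : (k : ℝ) ^ n = k ^ (n - 1) * k := by rw [← pow_succ]; congr 1; omega
      have hδt := hδ0 t
      rw [div_le_div_iff₀ (by positivity) hε]
      calc C * b t * ε = C * (b t * ε) := by ring
        _ ≤ C * (2 * S * δ t) := by gcongr
        _ = 2 * C * B * k * ((k : ℝ) ^ (n - 1) * δ t) := by rw [hS, hKn]; ring
    calc (((Finset.range (l - 1)).biUnion J).card : ℝ)
        ≤ ∑ t ∈ Finset.range (l - 1), (M t : ℝ) := by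
          simp_rw [← hJ]
          exact_mod_cast Finset.card_biUnion_le
      _ ≤ ∑ t ∈ Finset.range (l - 1), Real.exp (2 * C * B * k / ε) := Finset.sum_le_sum hexp
      _ = ((l - 1 : ℕ) : ℝ) * Real.exp (2 * C * B * k / ε) := by simp
      _ ≤ l * Real.exp (2 * C * B * k / ε) := by
          gcongr
          exact Nat.sub_le l 1

end GridJunta

theorem theorem3p2 :
    (∃ C₃ : ℝ, 0 < C₃ ∧
      ∀ k n l : ℕ, 1 ≤ k → 1 ≤ n → 1 ≤ l → ∀ (f : GridJunta.Grid k n → Fin l) (B : ℝ),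
        GridJunta.sumEdgeDiff (GridJunta.toReal f) ≤ B → ∀ ε : ℝ, 0 < ε →
          ∃ (M : ℕ) (g : GridJunta.Grid k n → Fin l), GridJunta.IsJunta M g ∧
            GridJunta.IsClose ε (GridJunta.toReal f) (GridJunta.toReal g) ∧
            (M : ℝ) ≤ l * Real.exp (C₃ * B * k / ε)) ∧
    (∀ C₁ : ℝ, GridJunta.BooleanJuntaConstant C₁ → GridJunta.SumJuntaConstant (2 * C₁)) :=
  ⟨⟨2 * 80, by norm_num, GridJunta.booleanJuntaConstant.sumJuntaConstant⟩,
    fun _ h => h.sumJuntaConstant⟩
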